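/- For an infinite word $u$ let $p_u(n)$ be the number of distinct factors of length $n$ of $u$; $u$ is called Sturmian if $p_u(n)=n+1$ for all $n\ge 0$. Let $\mathbf v$ be a Sturmian word over $\{a,b\}$ that contains $a^2$ (an $a$-Sturmian word), written in the form $$\mathbf v=a^{l_0}ba^{l+\epsilon_1}ba^{l+\epsilon_2}ba^{l+\epsilon_3}b\cdots ,$$ where $(\epsilon_i)_{i\ge1}$ is a Sturmian sequence over $\{0,1\}$ and $l,l_0$ are non-negative integers with $l_0\le l+1$. Let $F$ be the cellular automaton with local rule on $\{a,b\}^{l+1}$ sending $a^{l+1}$ to $a$ and every other word of length $l+1$ to $b$; thus the $i$-th letter of $F(\mathbf v)$ is $a$ if $v_iv_{i+1}\cdots v_{i+l}=a^{l+1}$, and $b$ otherwise. Then there is a largest integer $k_0$ such that the power $(a^lb)^{k_0}$ is a factor of $\mathbf v$, and with $n_0=k_0(l+1)$ we have, for all integers $n\ge 0$, $$p_{F(\mathbf v)}(n)=\begin{cases} n+1 & \text{if } n\le n_0-l,\\ 2n-n_0+l+1 & \text{if } n_0-l<n\le n_0,\\ n+l+1 & \text{if } n>n_0.\end{cases}$$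 -/

import Mathlib

namespace SturmianCA

/-- The two-letter alphabet `{a, b}`. -/
inductive AB : Type
  | a : AB
  | b : AB
  deriving DecidableEq

/-- An infinite word over `α` is a map `ℕ → α`; `window u i n` is the finite word
`u_i u_{i+1} ⋯ u_{i+n-1}` read in `u` at position `i`. -/
def window {α : Type*} (u : ℕ → α) (i n : ℕ) : List α :=
  (List.range n).map fun j => u (i + j)

/-- The finite word `w` is a factor of the infinite word `u`. -/
def IsFactor {α : Type*} (w : List α) (u : ℕ → α) : Prop :=
  ∃ i : ℕ, window u i w.length = w

/-- The finite word `w` is a prefix of the infinite word `u`. -/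
def IsPrefix {α : Type*} (w : List α) (u : ℕ → α) : Prop :=
  window u 0 w.length = w

/-- The set `L_n(u)` of factors of length `n` of `u`. -/
def factors {α : Type*} (u : ℕ → α) (n : ℕ) : Set (List α) :=
  {w | w.length = n ∧ IsFactor w u}

/-- The factor complexity function `p_u(n) = # L_n(u)`. -/
noncomputable def complexity {α : Type*} (u : ℕ → α) (n : ℕ) : ℕ :=
  (factors u n).ncard

/-- An infinite word is Sturmian if it has exactly `n + 1` factors of length `n`, for all `n`. -/
def IsSturmian {α : Type*} (u : ℕ → α) : Prop :=
  ∀ n : ℕ, complexity u n = n + 1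

/-- A Sturmian word over `{a, b}` is `a`-Sturmian if it contains `a²`. -/
def IsASturmian (v : ℕ → AB) : Prop :=
  IsSturmian v ∧ IsFactor [AB.a, AB.a] v

/-- The word `a^m b`. -/
def block (m : ℕ) : List AB :=
  List.replicate m AB.a ++ [AB.b]

/-- The power `w^k` of a finite word. -/
def wordPow {α : Type*} (w : List α) (k : ℕ) : List α :=
  (List.replicate k w).flatten

/-- `v = a^{l₀} b a^{l+ε₁} b a^{l+ε₂} b ⋯` : each of the finite words
`a^{l₀} b a^{l+ε₁} b ⋯ a^{l+εₘ} b` is a prefix of `v`. The sequence `ε` is indexed from `0`,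
so that `ε i` stands for the term of index `i + 1`. -/
def HasBlockForm (v : ℕ → AB) (l₀ l : ℕ) (ε : ℕ → Fin 2) : Prop :=
  ∀ m : ℕ, IsPrefix
    (block l₀ ++ (List.range m).flatMap fun i => block (l + (ε i : ℕ))) v

/-- The action on infinite words of the cellular automaton with local rule `f : A^r → B`:
`F(u) = f(u_0 ⋯ u_{r-1}) f(u_1 ⋯ u_r) f(u_2 ⋯ u_{r+1}) ⋯`. -/
def cellularAutomaton {α β : Type*} {r : ℕ} (f : (Fin r → α) → β) (u : ℕ → α) : ℕ → β :=
  fun i => f fun j => u (i + (j : ℕ))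

/-- The local rule on `{a, b}^{l+1}` sending `a^{l+1}` to `a` and every other word to `b`. -/
def powerRule (l : ℕ) : (Fin (l + 1) → AB) → AB :=
  fun w => if w = fun _ => AB.a then AB.a else AB.b

end SturmianCA

open SturmianCA

namespace SturmianCA

/-! Factors of length `n` of `F(v)` are images of the `n + l + 1` factors of length `n + l` of `v`,
so it suffices to measure how far this map is from injective. Occurrences of `b` in `v` are more
than `l` apart. Hence an `a` in the image exhibits `a^(l+1)` in `v`, and from there the rest of the
factor is recovered in both directions (`HasBlockForm.window_eq_of_image_eq`). Only `b^n` can have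
several preimages: they are the words with `b` exactly at the positions congruent to some `s ≤ l`
modulo `l + 1` (`HasBlockForm.exists_phase`). Phase `s` occurs iff `n + l ≤ n₀ + s`
(`HasBlockForm.isFactor_phaseWord_iff_le`, by recurrence and maximality of `k₀`). Replacing these
phases by the single word `b^n`, when it occurs, gives the three regimes. The exponent `k₀` exists
because `1` occurs in `ε` with bounded gaps. -/

/-! ### Factors, recurrence and bounded gaps in Sturmian words -/

theorem length_window {α : Type*} (u : ℕ → α) (i n : ℕ) : (window u i n).length = n := by
  simp [window]

theorem window_eq_window_iff {α : Type*} {u u' : ℕ → α} {i i' n : ℕ} :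
    window u i n = window u' i' n ↔ ∀ j < n, u (i + j) = u' (i' + j) := by
  simp [window]

theorem factors_eq_range {α : Type*} (u : ℕ → α) (n : ℕ) :
    factors u n = Set.range fun i => window u i n := by
  ext w
  constructor
  · rintro ⟨rfl, i, hi⟩
    exact ⟨i, hi⟩
  · rintro ⟨i, rfl⟩
    exact ⟨length_window u i n, i, by rw [length_window]⟩

theorem window_mem_factors {α : Type*} (u : ℕ → α) (i n : ℕ) : window u i n ∈ factors u n := by
  rw [factors_eq_range]
  exact ⟨i, rfl⟩

theorem IsSturmian.finite_factors {α : Type*} {u : ℕ → α} (hu : IsSturmian u) (n : ℕ) :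
    (factors u n).Finite :=
  Set.finite_of_ncard_pos (by have := hu n; rw [complexity] at this; omega)

theorem factors_shift_subset {α : Type*} (u : ℕ → α) (K n : ℕ) :
    factors (fun j => u (K + j)) n ⊆ factors u n := by
  rw [factors_eq_range, factors_eq_range]
  rintro _ ⟨i, rfl⟩
  exact ⟨K + i, by simp [window_eq_window_iff, add_assoc]⟩

/-- If the complexity does not increase from `m` to `m + 1`, then a factor of length `m`
determines everything that follows it. -/
theorem eq_of_complexity_succ_le {α : Type*} {u : ℕ → α} {m : ℕ}
    (hfin : (factors u (m + 1)).Finite) (h : complexity u (m + 1) ≤ complexity u m) {i j : ℕ}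
    (hij : window u i m = window u j m) (q : ℕ) : u (i + q) = u (j + q) := by
  have himg : (List.take m) '' factors u (m + 1) = factors u m := by
    have htake : ∀ i, List.take m (window u i (m + 1)) = window u i m := by
      intro i
      simp [window, ← List.map_take, List.take_range]
    rw [factors_eq_range, factors_eq_range, ← Set.range_comp]
    congr 1
    ext1 i
    exact htake i
  have hinj : Set.InjOn (List.take m) (factors u (m + 1)) := by
    apply Set.injOn_of_ncard_image_eq _ hfin
    refine le_antisymm (Set.ncard_image_le hfin) ?_
    rw [himg]
    exact h
  have step : ∀ i j, window u i m = window u j m → u (i + m) = u (j + m) := by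
    intro i j hij
    have := hinj (window_mem_factors u i (m + 1)) (window_mem_factors u j (m + 1)) (by
      simpa [window, ← List.map_take, List.take_range] using hij)
    exact window_eq_window_iff.1 this m (by omega)
  induction q using Nat.strong_induction_on with
  | _ q ih =>
    by_cases hq : q < m
    · exact window_eq_window_iff.1 hij q hq
    · have := step (i + (q - m)) (j + (q - m)) (window_eq_window_iff.2 fun t ht => by
        have := ih (q - m + t) (by omega)
        simpa [add_assoc] using this)
      rwa [add_assoc, add_assoc, Nat.sub_add_cancel (by omega)] at this

/-- Sturmian words are recurrent: every factor occurs arbitrarily far. -/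
theorem IsSturmian.recurrent {α : Type*} {u : ℕ → α} (hu : IsSturmian u) (i n K : ℕ) :
    ∃ i', K ≤ i' ∧ window u i' n = window u i n := by
  by_contra! hno
  set u' : ℕ → α := fun j => u (K + j) with hu'
  have hfin : ∀ m, (factors u' m).Finite := fun m =>
    (hu.finite_factors m).subset (factors_shift_subset u K m)
  have hlt : complexity u' n < n + 1 := by
    rw [← hu n]
    refine Set.ncard_lt_ncard ⟨factors_shift_subset u K n, fun hsub => ?_⟩ (hu.finite_factors n)
    have := hsub (window_mem_factors u i n)
    rw [factors_eq_range] at this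
    obtain ⟨i', hi'⟩ := this
    refine hno (K + i') (by omega) ?_
    rw [← hi']
    simp [window_eq_window_iff, hu', add_assoc]
  -- Morse–Hedlund: a complexity that always increased would be at least `n + 1` at `n`. Once it
  -- stalls it stays bounded, while dropping `K` letters loses at most `K` factors of each length.
  obtain ⟨m, hm⟩ : ∃ m, complexity u' (m + 1) ≤ complexity u' m := by
    by_contra! hinc
    have hge : ∀ m, m + 1 ≤ complexity u' m := by
      intro m
      induction m with
      | zero =>
        exact (Set.ncard_pos (hfin 0)).2 ⟨_, window_mem_factors u' 0 0⟩
      | succ m ih => have := hinc m; omega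
    have := hge n
    omega
  have hbound : ∀ k, complexity u' k ≤ complexity u' m := by
    intro k
    have hfac : (fun i => window u' i k).FactorsThrough fun i => window u' i m := by
      intro i j hij
      exact window_eq_window_iff.2 fun q _ => eq_of_complexity_succ_le (hfin _) hm hij q
    obtain ⟨φ, hφ⟩ := (Function.factorsThrough_iff _).1 hfac
    have : factors u' k = φ '' factors u' m := by
      rw [factors_eq_range, factors_eq_range, ← Set.range_comp, hφ]
    rw [complexity, this]
    exact Set.ncard_image_le (hfin m)
  have hK : ∀ k, complexity u k ≤ complexity u' k + K := by
    intro k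
    have hsub : factors u k ⊆ factors u' k ∪ (fun i => window u i k) '' (Set.Iio K) := by
      rw [factors_eq_range, factors_eq_range]
      rintro _ ⟨i, rfl⟩
      by_cases hi : i < K
      · exact Or.inr ⟨i, hi, rfl⟩
      · refine Or.inl ⟨i - K, window_eq_window_iff.2 fun j _ => ?_⟩
        simp only [hu']
        congr 1
        omega
    have hfinI : ((fun i => window u i k) '' (Set.Iio K)).Finite := (Set.finite_Iio K).image _
    calc complexity u k ≤ (factors u' k ∪ (fun i => window u i k) '' (Set.Iio K)).ncard :=
          Set.ncard_le_ncard hsub ((hfin k).union hfinI)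
      _ ≤ complexity u' k + ((fun i => window u i k) '' (Set.Iio K)).ncard :=
          Set.ncard_union_le _ _
      _ ≤ complexity u' k + K := by
          gcongr
          refine (Set.ncard_image_le (Set.finite_Iio K)).trans ?_
          simp
  have h1 := hK (complexity u' m + K)
  have h2 := hbound (complexity u' m + K)
  rw [hu] at h1
  omega

theorem IsSturmian.exists_ge_eq {α : Type*} {u : ℕ → α} (hu : IsSturmian u) (i K : ℕ) :
    ∃ i', K ≤ i' ∧ u i' = u i := by
  obtain ⟨i', h, h'⟩ := hu.recurrent i 1 K
  exact ⟨i', h, by simpa using window_eq_window_iff.1 h' 0 one_pos⟩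

/-- In a Sturmian word the gaps between the occurrences of a letter are bounded. -/
theorem IsSturmian.exists_gap_bound {α : Type*} {u : ℕ → α} (hu : IsSturmian u) {p : ℕ} :
    ∃ n, ∀ i, ∃ j < n, u (i + j) = u p := by
  by_contra! hfree
  set x := u p
  obtain ⟨p', hp', hp'x⟩ := hu.exists_ge_eq p (p + 1)
  obtain ⟨d, rfl⟩ := Nat.exists_eq_add_of_le hp'
  -- With this length, the window at `p` both starts and ends with `x`.
  set n := d + 2 with hn
  -- for every `j ≤ n` a window of length `n` in which exactly the last `j` letters avoid `x`
  have hex : ∀ j ≤ n, ∃ i, (∀ t < j, u (i + (n - 1 - t)) ≠ x) ∧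
      (j < n → u (i + (n - 1 - j)) = x) := by
    intro j hj
    rcases hj.eq_or_lt with rfl | hj
    · obtain ⟨i, hi⟩ := hfree n
      exact ⟨i, fun t ht => hi _ (by omega), fun h => absurd h (lt_irrefl _)⟩
    · obtain ⟨i, hi⟩ := hfree j
      -- Move the `x`-free factor beyond an `x`, then slide back to the last `x` before it. Taking
      -- `r ≥ n` keeps the start `s + j + 1 - n` free of truncation.
      obtain ⟨r, hr, hrx⟩ := hu.exists_ge_eq p n
      obtain ⟨i', hi', hw⟩ := hu.recurrent i j (r + 1)
      classical
      set P : ℕ → Prop := fun s => u s = x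
      set s := Nat.findGreatest P (i' - 1) with hs
      have hrs : r ≤ s := Nat.le_findGreatest (by omega) hrx
      have hsx : u s = x := Nat.findGreatest_spec (P := P) (m := r) (by omega) hrx
      have hsi : s ≤ i' - 1 := Nat.findGreatest_le _
      refine ⟨s + j + 1 - n, fun t ht => ?_, fun _ => ?_⟩
      · have e : s + j + 1 - n + (n - 1 - t) = s + j - t := by omega
        rw [e]
        by_cases hlt : s + j - t ≤ i' - 1
        · exact Nat.findGreatest_is_greatest (P := P) (n := i' - 1) (by omega) hlt
        · have h1 := window_eq_window_iff.1 hw (s + j - t - i') (by omega)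
          have h2 := hi (s + j - t - i') (by omega)
          rw [← h1] at h2
          rwa [Nat.add_sub_cancel' (by omega)] at h2
      · have e : s + j + 1 - n + (n - 1 - j) = s := by omega
        rw [e, hsx]
  choose! f hf using hex
  -- These `n + 1` windows differ in their number of trailing letters other than `x`, so they are
  -- all the factors of length `n`; only one of them ends with `x`.
  have himg : (fun j => window u (f j) n) '' (Set.Iic n) = factors u n := by
    apply Set.eq_of_subset_of_ncard_le _ _ (hu.finite_factors n)
    · rintro _ ⟨j, -, rfl⟩
      exact window_mem_factors _ _ _
    · rw [Set.InjOn.ncard_image]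
      · have := hu n
        rw [complexity] at this
        rw [this]
        simp
      · have key : ∀ j ≤ n, ∀ j' ≤ n, window u (f j) n = window u (f j') n → ¬ j < j' := by
          intro j hj j' hj' he hlt
          have h1 := (hf j hj).2 (by omega)
          have h2 := (hf j' hj').1 j hlt
          have h3 := window_eq_window_iff.1 he (n - 1 - j) (by omega)
          exact h2 (h3 ▸ h1)
        intro j hj j' hj' he
        have h1 := key j hj j' hj' he
        have h2 := key j' hj' j hj he.symm
        omega
  have huniq : ∀ i, u (i + (n - 1)) = x → window u i n = window u (f 0) n := by
    intro i hi
    have := window_mem_factors u i n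
    rw [← himg] at this
    obtain ⟨j, hj, he⟩ := this
    rcases Nat.eq_zero_or_pos j with rfl | hj0
    · exact he.symm
    · have h1 := (hf j hj).1 0 hj0
      have h2 := window_eq_window_iff.1 he (n - 1) (by omega)
      exact absurd (h2.trans hi) h1
  have hback : ∀ i, u (i + (n - 1)) = x → u i = x := by
    intro i hi
    have h1 := (huniq i hi).trans (huniq p (by
      rw [show p + (n - 1) = p + 1 + d by omega]; exact hp'x)).symm
    simpa using window_eq_window_iff.1 h1 0 (by omega)
  obtain ⟨i, hi⟩ := hfree n
  have hxr : ∃ r, u (i + r) = x := by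
    obtain ⟨r, hr, hrx⟩ := hu.exists_ge_eq p i
    exact ⟨r - i, by rwa [Nat.add_sub_cancel' hr]⟩
  classical
  have hr := Nat.find_spec hxr
  set r := Nat.find hxr
  have hrn : n ≤ r := by
    by_contra hlt
    exact hi r (by omega) hr
  -- The first `x` after an `x`-free stretch would force another `x` exactly `n - 1` places earlier,
  -- inside the stretch or before the first `x`.
  refine Nat.find_min hxr (m := r - (n - 1)) (by omega) (hback _ ?_)
  rwa [add_assoc, Nat.sub_add_cancel (by omega)]

/-! ### Positions of `b` in the block form -/

theorem AB.ne_a_iff {x : AB} : x ≠ AB.a ↔ x = AB.b := by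
  cases x <;> simp

theorem AB.eq_iff {x y : AB} : x = y ↔ (x = AB.b ↔ y = AB.b) := by
  cases x <;> cases y <;> simp

theorem length_block (m : ℕ) : (block m).length = m + 1 := by
  simp [block]

theorem getElem?_block {m j : ℕ} (hj : j ≤ m) :
    (block m)[j]? = some (if j = m then AB.b else AB.a) := by
  rcases hj.eq_or_lt with rfl | h
  · simp [block]
  · simp [block, List.getElem?_append_left, h, h.ne]

theorem getElem?_window {α : Type*} (u : ℕ → α) {i n j : ℕ} (hj : j < n) :
    (window u i n)[j]? = some (u (i + j)) := by
  simp [window, hj]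

theorem IsPrefix.eq_of_getElem? {α : Type*} {w : List α} {u : ℕ → α} (h : IsPrefix w u) {j : ℕ}
    {x : α} (hj : w[j]? = some x) : u j = x := by
  have hlt : j < w.length := by
    by_contra hge
    rw [List.getElem?_eq_none (by omega)] at hj
    cases hj
  have := getElem?_window u (i := 0) hlt
  rw [h, hj, zero_add] at this
  exact (Option.some.inj this).symm

/-- The position at which the block `a^{l+ε_m} b` starts. -/
def blockStart (l₀ l : ℕ) (ε : ℕ → Fin 2) : ℕ → ℕ
  | 0 => l₀ + 1
  | m + 1 => blockStart l₀ l ε m + (l + (ε m : ℕ) + 1)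

theorem length_prefix (l₀ l : ℕ) (ε : ℕ → Fin 2) (m : ℕ) :
    (block l₀ ++ (List.range m).flatMap fun i => block (l + (ε i : ℕ))).length =
      blockStart l₀ l ε m := by
  induction m with
  | zero => simp [blockStart, length_block]
  | succ m ih =>
    rw [List.range_succ, List.flatMap_append, ← List.append_assoc, List.length_append, ih,
      blockStart]
    simp [length_block]

section BlockForm

variable {v : ℕ → AB} {l₀ l : ℕ} {ε : ℕ → Fin 2}

theorem HasBlockForm.apply_blockStart_add (h : HasBlockForm v l₀ l ε) {m j : ℕ}
    (hj : j ≤ l + (ε m : ℕ)) :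
    v (blockStart l₀ l ε m + j) = if j = l + (ε m : ℕ) then AB.b else AB.a := by
  apply (h (m + 1)).eq_of_getElem?
  rw [List.range_succ, List.flatMap_append, ← List.append_assoc,
    List.getElem?_append_right (by rw [length_prefix]; omega), length_prefix,
    Nat.add_sub_cancel_left]
  simpa using getElem?_block hj

theorem HasBlockForm.apply_le (h : HasBlockForm v l₀ l ε) {j : ℕ} (hj : j ≤ l₀) :
    v j = if j = l₀ then AB.b else AB.a := by
  apply (h 0).eq_of_getElem?
  simpa using getElem?_block hj

theorem exists_blockStart_le (l₀ l : ℕ) (ε : ℕ → Fin 2) {p : ℕ} (hp : l₀ < p) :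
    ∃ m j, j ≤ l + (ε m : ℕ) ∧ p = blockStart l₀ l ε m + j := by
  induction p, hp using Nat.le_induction with
  | base => exact ⟨0, 0, by omega, rfl⟩
  | succ p hp ih =>
    obtain ⟨m, j, hj, rfl⟩ := ih
    rcases hj.eq_or_lt with rfl | hj
    · exact ⟨m + 1, 0, by omega, by simp only [blockStart]; omega⟩
    · exact ⟨m, j + 1, hj, by omega⟩

theorem HasBlockForm.exists_of_eq_b (h : HasBlockForm v l₀ l ε) {p : ℕ} (hp : v p = AB.b) :
    p = l₀ ∨ ∃ m, p = blockStart l₀ l ε m + (l + (ε m : ℕ)) := by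
  rcases lt_trichotomy p l₀ with hlt | rfl | hlt
  · rw [h.apply_le hlt.le, if_neg hlt.ne] at hp
    cases hp
  · exact Or.inl rfl
  · obtain ⟨m, j, hj, rfl⟩ := exists_blockStart_le l₀ l ε hlt
    rw [h.apply_blockStart_add hj] at hp
    split_ifs at hp with hjl
    exact Or.inr ⟨m, by rw [hjl]⟩

theorem HasBlockForm.exists_blockStart_eq_succ (h : HasBlockForm v l₀ l ε) {p : ℕ}
    (hp : v p = AB.b) : ∃ m, p + 1 = blockStart l₀ l ε m := by
  rcases h.exists_of_eq_b hp with rfl | ⟨m, rfl⟩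
  · exact ⟨0, rfl⟩
  · exact ⟨m + 1, by simp only [blockStart]; omega⟩

/-- Two occurrences of `b` are at distance more than `l`. -/
theorem HasBlockForm.ne_b_of_eq_b (h : HasBlockForm v l₀ l ε) {p t : ℕ} (hp : v p = AB.b)
    (ht : 1 ≤ t) (htl : t ≤ l) : v (p + t) ≠ AB.b := by
  obtain ⟨m, hm⟩ := h.exists_blockStart_eq_succ hp
  have := h.apply_blockStart_add (m := m) (j := t - 1) (by omega)
  rw [← hm, if_neg (by omega), show p + 1 + (t - 1) = p + t by omega] at this
  rw [this]
  simp

/-- Every occurrence of `b` except the first is preceded by `a^l`. -/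
theorem HasBlockForm.sub_ne_b_of_eq_b (h : HasBlockForm v l₀ l ε) {p : ℕ} (hp : v p = AB.b)
    (hlt : l₀ < p) : l ≤ p ∧ ∀ t, 1 ≤ t → t ≤ l → v (p - t) ≠ AB.b := by
  rcases h.exists_of_eq_b hp with rfl | ⟨m, rfl⟩
  · omega
  · refine ⟨by omega, fun t ht htl => ?_⟩
    have := h.apply_blockStart_add (m := m) (j := l + (ε m : ℕ) - t) (by omega)
    rw [if_neg (by omega)] at this
    rw [Nat.add_sub_assoc (by omega), this]
    simp

end BlockForm

/-! ### Phase words and powers of `a^l b` -/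

/-- Exactly one of `l + 1` consecutive integers lies in a given residue class. -/
theorem add_mod_eq_iff {l q s : ℕ} (hs : s ≤ l) :
    (∀ j < l, (q + j) % (l + 1) ≠ s) ↔ (q + l) % (l + 1) = s := by
  have hc : q % (l + 1) < l + 1 := Nat.mod_lt _ (by omega)
  have key : ∀ j ≤ l, (q + j) % (l + 1) =
      if q % (l + 1) + j < l + 1 then q % (l + 1) + j else q % (l + 1) + j - (l + 1) := by
    intro j hj
    rw [Nat.add_mod, Nat.mod_eq_of_lt (show j < l + 1 by omega)]
    split_ifs with hlt
    · exact Nat.mod_eq_of_lt hlt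
    · rw [Nat.mod_eq_sub_mod (by omega), Nat.mod_eq_of_lt (by omega)]
  constructor
  · intro h
    by_contra hne
    rw [key l le_rfl] at hne
    by_cases hcs : q % (l + 1) ≤ s
    · have hlt : s - q % (l + 1) < l := by
        split_ifs at hne <;> omega
      apply h _ hlt
      rw [key _ hlt.le, if_pos (by omega)]
      omega
    · have hlt : s + (l + 1) - q % (l + 1) < l := by
        split_ifs at hne <;> omega
      apply h _ hlt
      rw [key _ hlt.le, if_neg (by omega)]
      omega
  · intro h j hj
    rw [key l le_rfl] at h
    rw [key j hj.le]
    split_ifs at h ⊢ <;> omega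

/-- The word of length `n` in which `b` stands at the positions congruent to `s`
modulo `l + 1`. -/
def phaseWord (l s n : ℕ) : List AB :=
  (List.range n).map fun q => if q % (l + 1) = s then AB.b else AB.a

theorem length_phaseWord (l s n : ℕ) : (phaseWord l s n).length = n := by
  simp [phaseWord]

theorem window_eq_phaseWord_iff {v : ℕ → AB} {l s i n : ℕ} :
    window v i n = phaseWord l s n ↔ ∀ q < n, (v (i + q) = AB.b ↔ q % (l + 1) = s) := by
  simp only [window, phaseWord, List.map_inj_left, List.mem_range]
  refine forall₂_congr fun q _ => ?_
  split_ifs with h <;> simp [h, ← AB.ne_a_iff]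

theorem wordPow_block (l k : ℕ) : wordPow (block l) k = phaseWord l l (k * (l + 1)) := by
  induction k with
  | zero => simp [wordPow, phaseWord]
  | succ k ih =>
    have hb : block l = phaseWord l l (l + 1) := by
      apply List.ext_getElem?
      intro j
      rcases lt_or_ge j (l + 1) with hj | hj
      · rw [getElem?_block (by omega)]
        simp [phaseWord, hj, Nat.mod_eq_of_lt hj]
      · rw [List.getElem?_eq_none (by rwa [length_block]),
          List.getElem?_eq_none (by rwa [length_phaseWord])]
    have hs : wordPow (block l) (k + 1) = block l ++ wordPow (block l) k := by
      simp [wordPow, List.replicate_succ]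
    rw [hs, ih, hb, phaseWord, phaseWord, phaseWord, add_mul, one_mul, add_comm (k * (l + 1)),
      @List.range_add (l + 1), List.map_append, List.map_map]
    congr 2
    ext1 q
    simp

/-- Occurrence of a word as a factor at some position, in terms of phases. -/
theorem isFactor_phaseWord_iff {v : ℕ → AB} {l s n : ℕ} :
    IsFactor (phaseWord l s n) v ↔
      ∃ i, ∀ q < n, (v (i + q) = AB.b ↔ q % (l + 1) = s) := by
  simp only [IsFactor, length_phaseWord, window_eq_phaseWord_iff]

theorem cellularAutomaton_powerRule_eq_b_iff {l : ℕ} {v : ℕ → AB} {p : ℕ} :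
    cellularAutomaton (powerRule l) v p = AB.b ↔ ∃ j ≤ l, v (p + j) = AB.b := by
  simp only [cellularAutomaton, powerRule]
  rw [← AB.ne_a_iff, Ne, ite_eq_left_iff]
  simp only [reduceCtorEq, imp_false, not_not, funext_iff, not_forall, ← Ne.eq_def, AB.ne_a_iff]
  constructor
  · rintro ⟨j, hj⟩
    exact ⟨j, by omega, hj⟩
  · rintro ⟨j, hjl, hj⟩
    exact ⟨⟨j, by omega⟩, hj⟩

/-! ### Recovering factors of `v` from their images -/

section BlockForm

variable {v : ℕ → AB} {l₀ l : ℕ} {ε : ℕ → Fin 2}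

/-- A stretch of `l + 1` letters holds at most one `b`. This rule determines a letter from the image
and the `l` letters before it, so it propagates knowledge to the right; `HasBlockForm.eq_b_iff` does
so to the left. -/
theorem HasBlockForm.add_eq_b_iff (h : HasBlockForm v l₀ l ε) {p : ℕ} :
    v (p + l) = AB.b ↔
      cellularAutomaton (powerRule l) v p = AB.b ∧ ∀ j < l, v (p + j) ≠ AB.b := by
  rw [cellularAutomaton_powerRule_eq_b_iff]
  constructor
  · refine fun hb => ⟨⟨l, le_rfl, hb⟩, fun j hj hjb => ?_⟩
    refine h.ne_b_of_eq_b hjb (t := l - j) (by omega) (by omega) ?_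
    rwa [add_assoc, Nat.add_sub_cancel' hj.le]
  · rintro ⟨⟨j, hj, hjb⟩, hne⟩
    rcases hj.eq_or_lt with rfl | hj
    · exact hjb
    · exact absurd hjb (hne j hj)

theorem HasBlockForm.eq_b_iff (h : HasBlockForm v l₀ l ε) {p : ℕ} :
    v p = AB.b ↔ cellularAutomaton (powerRule l) v p = AB.b ∧
      ∀ t, 1 ≤ t → t ≤ l → v (p + t) ≠ AB.b := by
  rw [cellularAutomaton_powerRule_eq_b_iff]
  constructor
  · exact fun hb => ⟨⟨0, by omega, hb⟩, fun t ht htl => h.ne_b_of_eq_b hb ht htl⟩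
  · rintro ⟨⟨j, hj, hjb⟩, hne⟩
    rcases Nat.eq_zero_or_pos j with rfl | hj0
    · exact hjb
    · exact absurd hjb (hne j hj0 hj)

/-- A factor of the image containing an `a` determines the factor of `v` above it. -/
theorem HasBlockForm.window_eq_of_image_eq (h : HasBlockForm v l₀ l ε) {i i' n : ℕ}
    (hw : window (cellularAutomaton (powerRule l) v) i n =
      window (cellularAutomaton (powerRule l) v) i' n)
    {p : ℕ} (hp : p < n) (hpa : cellularAutomaton (powerRule l) v (i + p) ≠ AB.b) :
    window v i (n + l) = window v i' (n + l) := by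
  have hg := window_eq_window_iff.1 hw
  have hpa' : cellularAutomaton (powerRule l) v (i' + p) ≠ AB.b := by rwa [← hg p hp]
  rw [Ne, cellularAutomaton_powerRule_eq_b_iff] at hpa hpa'
  push Not at hpa hpa'
  have hright : ∀ q, p ≤ q → q < n + l → (v (i + q) = AB.b ↔ v (i' + q) = AB.b) := by
    intro q
    induction q using Nat.strong_induction_on with
    | _ q ih =>
      intro hpq hq
      by_cases hql : q ≤ p + l
      · have h1 := hpa (q - p) (by omega)
        have h2 := hpa' (q - p) (by omega)
        rw [add_assoc, Nat.add_sub_cancel' hpq] at h1 h2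
        simp [h1, h2]
      · obtain ⟨r, rfl⟩ : ∃ r, q = r + l := ⟨q - l, by omega⟩
        rw [← add_assoc, ← add_assoc, h.add_eq_b_iff, h.add_eq_b_iff, hg r (by omega)]
        refine and_congr_right fun _ => forall₂_congr fun j hj => not_congr ?_
        rw [add_assoc, add_assoc]
        exact ih (r + j) (by omega) (by omega) (by omega)
  have hleft : ∀ d, d ≤ p → (v (i + (p - d)) = AB.b ↔ v (i' + (p - d)) = AB.b) := by
    intro d
    induction d using Nat.strong_induction_on with
    | _ d ih =>
      intro hd
      rcases Nat.eq_zero_or_pos d with rfl | hd0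
      · exact hright p le_rfl (by omega)
      · rw [h.eq_b_iff, h.eq_b_iff, hg (p - d) (by omega)]
        refine and_congr_right fun _ => forall₃_congr fun t ht htl => not_congr ?_
        rw [add_assoc, add_assoc]
        by_cases htd : t ≤ d
        · have := ih (d - t) (by omega) (by omega)
          rwa [show p - (d - t) = p - d + t by omega] at this
        · exact hright _ (by omega) (by omega)
  refine window_eq_window_iff.2 fun q hq => AB.eq_iff.2 ?_
  by_cases hpq : p ≤ q
  · exact hright q hpq hq
  · have := hleft (p - q) (by omega)
    rwa [Nat.sub_sub_self (by omega)] at this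

/-- The factors of `v` whose image is a power of `b` are the phase words. -/
theorem HasBlockForm.exists_phase (h : HasBlockForm v l₀ l ε) {i n : ℕ}
    (hg : ∀ p < n, cellularAutomaton (powerRule l) v (i + p) = AB.b) :
    ∃ s ≤ l, window v i (n + l) = phaseWord l s (n + l) := by
  -- The first `l` letters contain at most one `b`; the value `s = l` encodes that there is none.
  obtain ⟨s, hs, hfirst⟩ : ∃ s ≤ l, ∀ q < l, (v (i + q) = AB.b ↔ q = s) := by
    by_cases hb : ∃ s < l, v (i + s) = AB.b
    · obtain ⟨s, hs, hsb⟩ := hb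
      refine ⟨s, hs.le, fun q hq => ⟨fun hqb => ?_, fun e => e ▸ hsb⟩⟩
      have key : ∀ x y, y < l → v (i + x) = AB.b → v (i + y) = AB.b → ¬ x < y := by
        intro x y hy hx hyb hlt
        refine h.ne_b_of_eq_b hx (t := y - x) (by omega) (by omega) ?_
        rwa [add_assoc, Nat.add_sub_cancel' hlt.le]
      have h1 := key q s hs hqb hsb
      have h2 := key s q hq hsb hqb
      omega
    · push Not at hb
      exact ⟨l, le_rfl, fun q hq => iff_of_false (hb q hq) hq.ne⟩
  refine ⟨s, hs, window_eq_phaseWord_iff.2 fun q => ?_⟩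
  induction q using Nat.strong_induction_on with
  | _ q ih =>
    intro hq
    by_cases hql : q < l
    · rw [hfirst q hql, Nat.mod_eq_of_lt (by omega)]
    · obtain ⟨r, rfl⟩ : ∃ r, q = r + l := ⟨q - l, by omega⟩
      rw [← add_mod_eq_iff hs, ← add_assoc, h.add_eq_b_iff, and_iff_right (hg r (by omega))]
      refine forall₂_congr fun j hj => not_congr ?_
      rw [add_assoc]
      exact ih (r + j) (by omega) (by omega)

theorem image_eq_b_of_window_eq_phaseWord {i n s : ℕ} (hs : s ≤ l)
    (hw : window v i (n + l) = phaseWord l s (n + l)) {p : ℕ} (hp : p < n) :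
    cellularAutomaton (powerRule l) v (i + p) = AB.b := by
  rw [window_eq_phaseWord_iff] at hw
  rw [cellularAutomaton_powerRule_eq_b_iff]
  by_contra! hne
  have h1 : ∀ j ≤ l, (p + j) % (l + 1) ≠ s := fun j hj => by
    have := hne j hj
    rwa [add_assoc, Ne, hw (p + j) (by omega)] at this
  exact h1 l le_rfl ((add_mod_eq_iff hs).1 fun j hj => h1 j hj.le)

theorem phaseWord_injOn (l n : ℕ) : Set.InjOn (fun s => phaseWord l s (n + l)) (Set.Iic l) := by
  have key : ∀ s s', s ≤ l → s' ≤ l → phaseWord l s (n + l) = phaseWord l s' (n + l) →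
      ¬ s < s' := by
    intro s s' hs hs' he hlt
    simp only [phaseWord, List.map_inj_left, List.mem_range] at he
    have := he s (by omega)
    rw [Nat.mod_eq_of_lt (by omega), if_pos rfl, if_neg hlt.ne] at this
    cases this
  intro s hs s' hs' he
  have h1 := key s s' hs hs' he
  have h2 := key s' s hs' hs he.symm
  omega

/-! ### The largest power of `a^l b` in `v` -/

theorem add_mod_eq_left_iff {l s r : ℕ} (hs : s ≤ l) :
    (s + r) % (l + 1) = s ↔ r % (l + 1) = 0 := by
  have e1 : (s + r) % (l + 1) = s ↔ s + r ≡ s + 0 [MOD l + 1] := by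
    rw [Nat.ModEq, add_zero, Nat.mod_eq_of_lt (show s < l + 1 by omega)]
  have e2 : r % (l + 1) = 0 ↔ r ≡ 0 [MOD l + 1] := by
    rw [Nat.ModEq, Nat.zero_mod]
  rw [e1, e2]
  exact ⟨Nat.ModEq.add_left_cancel' _, Nat.ModEq.add_left _⟩

/-- A power of exponent `k` forces `k - 1` consecutive zeros in `ε`, one for each copy after the
first, and such runs are bounded. -/
theorem HasBlockForm.exists_wordPow_bound (h : HasBlockForm v l₀ l ε) (hε : IsSturmian ε) :
    ∃ K, ∀ k, IsFactor (wordPow (block l) k) v → k ≤ K := by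
  obtain ⟨p, hp⟩ : ∃ p, ε p ≠ 0 := by
    by_contra! h0
    have hsub : factors ε 1 ⊆ {window ε 0 1} := by
      rw [factors_eq_range]
      rintro _ ⟨i, rfl⟩
      exact window_eq_window_iff.2 fun j _ => by rw [h0, h0]
    have h1 := Set.ncard_le_ncard hsub
    have h2 := hε 1
    rw [complexity] at h2
    rw [h2, Set.ncard_singleton] at h1
    omega
  obtain ⟨n, hn⟩ := hε.exists_gap_bound (p := p)
  refine ⟨n + 1, fun k hk => ?_⟩
  by_contra! hlt
  rw [wordPow_block, isFactor_phaseWord_iff] at hk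
  obtain ⟨i, hi⟩ := hk
  have hb : ∀ j < k, v (i + (j * (l + 1) + l)) = AB.b := by
    intro j hj
    refine (hi _ ?_).2 ?_
    · calc j * (l + 1) + l < (j + 1) * (l + 1) := by rw [add_mul]; omega
        _ ≤ k * (l + 1) := Nat.mul_le_mul_right _ hj
    · rw [mul_comm, Nat.mul_add_mod, Nat.mod_eq_of_lt (Nat.lt_succ_self l)]
  obtain ⟨m, hm⟩ := h.exists_blockStart_eq_succ (hb 0 (by omega))
  have hzero : ∀ j, j + 1 < k →
      blockStart l₀ l ε (m + j) = i + (j + 1) * (l + 1) → ε (m + j) = 0 := by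
    intro j hj hS
    have h1 := h.apply_blockStart_add (m := m + j) (j := l) (by omega)
    rw [hS, add_assoc, hb (j + 1) hj] at h1
    split_ifs at h1 with h2
    exact Fin.ext (by simpa using h2)
  have hS : ∀ j, j + 1 < k → blockStart l₀ l ε (m + j) = i + (j + 1) * (l + 1) := by
    intro j
    induction j with
    | zero => intro _; rw [add_zero, ← hm]; ring
    | succ j ih =>
      intro hj
      have h1 := ih (by omega)
      have h2 := hzero j (by omega) h1
      rw [← add_assoc, blockStart, h1, h2, Fin.val_zero]
      ring
  obtain ⟨j, hj, hjp⟩ := hn m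
  rw [hzero j (by omega) (hS j (by omega))] at hjp
  exact hp hjp.symm

/-- Which phase words occur in `v`. -/
theorem HasBlockForm.isFactor_phaseWord_iff_le (h : HasBlockForm v l₀ l ε) (hv : IsSturmian v)
    {k₀ : ℕ} (hk : IsGreatest {k : ℕ | IsFactor (wordPow (block l) k) v} k₀) {s n : ℕ}
    (hs : s ≤ l) :
    IsFactor (phaseWord l s (n + l)) v ↔ n + l ≤ k₀ * (l + 1) + s := by
  constructor
  · intro hf
    by_contra! hlt
    obtain ⟨i, hi⟩ := isFactor_phaseWord_iff.1 hf
    -- Start at the first `b` of the phase word and move it past `l₀`. There `a^l` must precede it,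
    -- which completes a power of exponent `k₀ + 1`.
    obtain ⟨i', hi', hw⟩ := hv.recurrent (i + s) (k₀ * (l + 1) + 1) (l₀ + 1)
    have hpat : ∀ r ≤ k₀ * (l + 1), (v (i' + r) = AB.b ↔ r % (l + 1) = 0) := by
      intro r hr
      rw [window_eq_window_iff.1 hw r (by omega), add_assoc, hi _ (by omega),
        add_mod_eq_left_iff hs]
    obtain ⟨hl, hpre⟩ := h.sub_ne_b_of_eq_b ((hpat 0 (by omega)).2 (Nat.zero_mod _)) hi'
    have hmem : k₀ + 1 ∈ {k : ℕ | IsFactor (wordPow (block l) k) v} := by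
      change IsFactor _ v
      rw [wordPow_block, isFactor_phaseWord_iff]
      refine ⟨i' - l, fun q hq => ?_⟩
      by_cases hql : q < l
      · rw [Nat.mod_eq_of_lt (by omega)]
        refine iff_of_false ?_ hql.ne
        have := hpre (l - q) (by omega) (by omega)
        rwa [show i' + 0 - (l - q) = i' - l + q by omega] at this
      · obtain ⟨r, rfl⟩ := Nat.exists_eq_add_of_le (not_lt.1 hql)
        rw [add_mul] at hq
        rw [add_mod_eq_left_iff le_rfl, ← hpat r (by omega)]
        rw [← add_assoc, Nat.sub_add_cancel (by omega)]
    have := hk.2 hmem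
    omega
  · intro hle
    -- The maximal power extends by `a^l`; every phase word to be found is then read inside it, from
    -- offset `l - s`.
    obtain ⟨i, hi⟩ : ∃ i, ∀ q < k₀ * (l + 1) + l, (v (i + q) = AB.b ↔ q % (l + 1) = l) := by
      rcases Nat.eq_zero_or_pos k₀ with rfl | hpos
      · refine ⟨blockStart l₀ l ε 0, fun q hq => ?_⟩
        rw [h.apply_blockStart_add (by omega), if_neg (by omega), Nat.mod_eq_of_lt (by omega)]
        exact iff_of_false (by simp) (by omega)
      · obtain ⟨i, hi⟩ := isFactor_phaseWord_iff.1
          (wordPow_block l k₀ ▸ (show IsFactor (wordPow (block l) k₀) v from hk.1))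
        refine ⟨i, fun q hq => ?_⟩
        by_cases hqk : q < k₀ * (l + 1)
        · exact hi q hqk
        · obtain ⟨r, rfl⟩ := Nat.exists_eq_add_of_le (not_lt.1 hqk)
          obtain ⟨k, rfl⟩ : ∃ k, k₀ = k + 1 := ⟨k₀ - 1, by omega⟩
          have hb : v (i + (k * (l + 1) + l)) = AB.b := by
            refine (hi _ (by rw [add_mul]; omega)).2 ?_
            rw [mul_comm, Nat.mul_add_mod, Nat.mod_eq_of_lt (Nat.lt_succ_self l)]
          have := h.ne_b_of_eq_b hb (t := r + 1) (by omega) (by omega)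
          rw [mul_comm, Nat.mul_add_mod, Nat.mod_eq_of_lt (by omega)]
          refine iff_of_false ?_ (by omega)
          rwa [show i + ((l + 1) * (k + 1) + r) = i + (k * (l + 1) + l) + (r + 1) by ring]
    refine isFactor_phaseWord_iff.2 ⟨i + (l - s), fun q hq => ?_⟩
    rw [add_assoc, hi _ (by omega)]
    have e1 : q % (l + 1) = s ↔ q ≡ s [MOD l + 1] := by
      rw [Nat.ModEq, Nat.mod_eq_of_lt (show s < l + 1 by omega)]
    have e2 : (l - s + q) % (l + 1) = l ↔ l - s + q ≡ l - s + s [MOD l + 1] := by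
      rw [Nat.ModEq, Nat.sub_add_cancel hs, Nat.mod_eq_of_lt (Nat.lt_succ_self l)]
    rw [e1, e2]
    exact ⟨Nat.ModEq.add_left_cancel' _, Nat.ModEq.add_left _⟩

end BlockForm

/-! ### Counting the factors of the image -/

/-- `B` factors through `A` by a map that is injective away from the fibre over `y`, so the two
ranges differ in size only by what lies over `y`. -/
theorem ncard_range_add_ncard_fiber {ι : Type*} {X Y : Type*} {A : ι → X} {B : ι → Y} (hA : (Set.range A).Finite)
    (y : Y) (hAB : ∀ i j, A i = A j → B i = B j)
    (hBA : ∀ i j, B i = B j → B i ≠ y → A i = A j) :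
    (Set.range B).ncard + (A '' {i | B i = y}).ncard =
      (Set.range A).ncard + (B '' {i | B i = y}).ncard := by
  rcases isEmpty_or_nonempty ι with hι | ⟨⟨i₀⟩⟩
  · simp [Set.range_eq_empty, Set.eq_empty_of_isEmpty]
  have : Nonempty Y := ⟨y⟩
  obtain ⟨φ, hφ⟩ := (Function.factorsThrough_iff (g := B) (f := A)).1 fun i j => hAB i j
  have hB : (Set.range B).Finite := by
    rw [hφ, Set.range_comp]
    exact hA.image φ
  have huniv : Set.univ = {i | B i = y} ∪ {i | B i ≠ y} := by
    ext i
    simp [em]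
  have hBeq : φ '' (A '' {i | B i ≠ y}) = B '' {i | B i ≠ y} := by
    rw [← Set.image_comp, ← hφ]
  have hinj : Set.InjOn φ (A '' {i | B i ≠ y}) := by
    rintro _ ⟨i, hi, rfl⟩ _ ⟨j, _, rfl⟩ he
    have e : ∀ i, φ (A i) = B i := fun i => (congrFun hφ i).symm
    rw [e, e] at he
    exact hBA i j he hi
  have hcard : (B '' {i | B i ≠ y}).ncard = (A '' {i | B i ≠ y}).ncard := by
    rw [← hBeq, hinj.ncard_image]
  have hfinA : ∀ s : Set ι, (A '' s).Finite := fun s => hA.subset (Set.image_subset_range _ _)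
  have hfinB : ∀ s : Set ι, (B '' s).Finite := fun s => hB.subset (Set.image_subset_range _ _)
  rw [← Set.image_univ, ← Set.image_univ, huniv, Set.image_union, Set.image_union,
    Set.ncard_union_eq _ (hfinA _) (hfinA _),
    Set.ncard_union_eq _ (hfinB _) (hfinB _), hcard]
  · ring
  · rw [Set.disjoint_left]
    rintro _ ⟨i, hi, rfl⟩ ⟨j, hj, he⟩
    exact hj (he.trans hi)
  · rw [Set.disjoint_left]
    rintro _ ⟨i, hi, rfl⟩ ⟨j, hj, he⟩
    exact hj ((hAB _ _ he).trans hi)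

theorem window_image_eq {v : ℕ → AB} {l i i' n : ℕ}
    (hw : window v i (n + l) = window v i' (n + l)) :
    window (cellularAutomaton (powerRule l) v) i n =
      window (cellularAutomaton (powerRule l) v) i' n := by
  refine window_eq_window_iff.2 fun p hp => ?_
  simp only [cellularAutomaton]
  congr 1
  ext1 j
  have := window_eq_window_iff.1 hw (p + j) (by omega)
  simpa [add_assoc] using this

/-- The truncated differences count the phases `s ≤ l` that occur: all `l + 1` for small `n`, none
once `n > n₀`. The last term records whether `b^n` occurs. -/
theorem HasBlockForm.complexity_image {v : ℕ → AB} {l₀ l : ℕ} {ε : ℕ → Fin 2}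
    (h : HasBlockForm v l₀ l ε) (hv : IsSturmian v)
    {k₀ : ℕ} (hk : IsGreatest {k : ℕ | IsFactor (wordPow (block l) k) v} k₀) (n : ℕ) :
    complexity (cellularAutomaton (powerRule l) v) n + (l + 1 - (n + l - k₀ * (l + 1))) =
      n + l + 1 + if n ≤ k₀ * (l + 1) then 1 else 0 := by
  set g := cellularAutomaton (powerRule l) v with hg
  set y : List AB := List.replicate n AB.b
  have hy : ∀ i, window g i n = y ↔ ∀ p < n, g (i + p) = AB.b := by
    intro i
    simp [y, window, List.eq_replicate_iff]
  have hcount := ncard_range_add_ncard_fiber (A := fun i => window v i (n + l))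
    (B := fun i => window g i n) (by rw [← factors_eq_range]; exact hv.finite_factors _) y
    (fun i j => window_image_eq) (fun i j he hne => by
      have hne' : ¬ window g i n = y := hne
      rw [hy] at hne'
      push Not at hne'
      obtain ⟨p, hp, hpa⟩ := hne'
      exact h.window_eq_of_image_eq he hp hpa)
  rw [← factors_eq_range, ← factors_eq_range] at hcount
  have hfiber : (fun i => window v i (n + l)) '' {i | window g i n = y} =
      (fun s => phaseWord l s (n + l)) '' (Finset.Icc (n + l - k₀ * (l + 1)) l : Finset ℕ) := by
    ext w
    simp only [Set.mem_image, Set.mem_ofPred_eq, hy, Finset.coe_Icc, Set.mem_Icc]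
    constructor
    · rintro ⟨i, hi, rfl⟩
      obtain ⟨s, hs, hw⟩ := h.exists_phase hi
      have hf : IsFactor (phaseWord l s (n + l)) v := ⟨i, by rw [length_phaseWord, hw]⟩
      rw [h.isFactor_phaseWord_iff_le hv hk hs] at hf
      exact ⟨s, ⟨by omega, hs⟩, hw.symm⟩
    · rintro ⟨s, ⟨hs1, hs⟩, rfl⟩
      obtain ⟨i, hi⟩ := (h.isFactor_phaseWord_iff_le hv hk hs (n := n)).2 (by omega)
      rw [length_phaseWord] at hi
      exact ⟨i, fun p hp => image_eq_b_of_window_eq_phaseWord hs hi hp, hi⟩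
  have hfcard : ((fun i => window v i (n + l)) '' {i | window g i n = y}).ncard =
      l + 1 - (n + l - k₀ * (l + 1)) := by
    rw [hfiber, Set.InjOn.ncard_image, Set.ncard_coe_finset, Nat.card_Icc]
    exact (phaseWord_injOn l n).mono fun s hs => by simp at hs; exact hs.2
  have hycard : ((fun i => window g i n) '' {i | window g i n = y}).ncard =
      if n ≤ k₀ * (l + 1) then 1 else 0 := by
    split_ifs with hn
    · rw [Set.ncard_eq_one]
      refine ⟨y, ?_⟩
      apply Set.Subset.antisymm
      · rintro _ ⟨i, hi, rfl⟩
        exact hi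
      · rintro _ rfl
        -- Phase `l` is the last to disappear as `n` grows, so it witnesses `b^n`.
        obtain ⟨i, hi⟩ := (h.isFactor_phaseWord_iff_le hv hk le_rfl (n := n)).2 (by omega)
        rw [length_phaseWord] at hi
        have := (hy i).2 fun p hp => image_eq_b_of_window_eq_phaseWord le_rfl hi hp
        exact ⟨i, this, this⟩
    · have h0 : {i | window g i n = y} = ∅ := by
        rw [← Set.image_eq_empty (f := fun i => window v i (n + l)), hfiber]
        rw [Finset.Icc_eq_empty (by omega)]
        simp
      rw [h0, Set.image_empty, Set.ncard_empty]
  rw [hfcard, hycard] at hcount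
  have hvn := hv (n + l)
  unfold complexity at hvn ⊢
  rw [hcount, hvn]

end SturmianCA

open SturmianCA
theorem theorem3 (v : ℕ → AB) (l₀ l : ℕ) (ε : ℕ → Fin 2)
    (hv : IsASturmian v) (hε : IsSturmian ε) (hl₀ : l₀ ≤ l + 1)
    (hform : HasBlockForm v l₀ l ε) :
    ∃ k₀ : ℕ, IsGreatest {k : ℕ | IsFactor (wordPow (block l) k) v} k₀ ∧
      ∀ n₀ : ℕ, n₀ = k₀ * (l + 1) →
        ∀ n : ℕ,
          ((n : ℤ) ≤ n₀ - l →
            (complexity (cellularAutomaton (powerRule l) v) n : ℤ) = n + 1) ∧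
          ((n₀ : ℤ) - l < n → n ≤ n₀ →
            (complexity (cellularAutomaton (powerRule l) v) n : ℤ) = 2 * n - n₀ + l + 1) ∧
          (n₀ < n →
            (complexity (cellularAutomaton (powerRule l) v) n : ℤ) = n + l + 1) := by
  obtain ⟨K, hK⟩ := hform.exists_wordPow_bound hε
  obtain ⟨k₀, hk₀⟩ : ∃ k₀, IsGreatest {k : ℕ | IsFactor (wordPow (block l) k) v} k₀ :=
    BddAbove.exists_isGreatest_of_nonempty ⟨K, fun k hk => hK k hk⟩
      ⟨0, 0, by simp [wordPow, window]⟩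
  refine ⟨k₀, hk₀, ?_⟩
  rintro n₀ hn₀ n
  have hc := hform.complexity_image hv.1 hk₀ n
  rw [← hn₀] at hc
  refine ⟨fun h1 => ?_, fun h1 h2 => ?_, fun h1 => ?_⟩
  · rw [if_pos (by omega)] at hc
    omega
  · rw [if_pos h2] at hc
    omega
  · rw [if_neg (by omega)] at hc
    omega
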